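/- Let $(V,g)$ be a smooth $n$-dimensional Lorentzian manifold of signature $(+,-,\dots,-)$, time-oriented by a smooth timelike vector field, and let $\Theta^+$ be the set of future-directed causal (nonzero, non-spacelike) vectors. A bilinear form $T$ on $T_pV$ is called causal if $T(u,v)\ge 0$ for all $u,v\in\Theta^+\cap T_pV$; a diffeomorphism $f:V\to V$ is called a causal symmetry if $f'(\Theta^+)\subseteq\Theta^+$. For null vectors $k_1,\dots,k_r$ at a point (identified with 1-forms through $g$), put $\Omega=k_1\wedge\dots\wedge k_r$ and let $$T\{\Omega\}_{ab}=\frac{(-1)^{r-1}}{(r-1)!}\Big(\Omega_{ac_2\dots c_r}\Omega_b{}^{c_2\dots c_r}-\frac1{2r}\,(\Omega\cdot\Omega)\,g_{ab}\Big),\qquad \Omega\cdot\Omega=\Omega_{c_1\dots c_r}\Omega^{c_1\dots c_r},$$ be its superenergy tensor. Let $\xi$ be a smooth vector field on $V$ with local flow $\{\varphi_s\}$, and suppose that one of the following holds. 1. (This contains both the case $r=n-1$ and the pure cases $1<r\le n-1$ with zero remainder.) For some $r$ with $2\le r\le n-1$ there are, at each point of $V$, $r$ linearly independent null vectors $k_1,\dots,k_r$,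 normalized so that $\Omega\cdot\Omega=2\,r!\,(-1)^{r-1}$, such that $S=T\{\Omega\}$ satisfies $$\pounds_\xi g=\alpha g+\beta S,\qquad \pounds_\xi S=\beta g+\alpha S$$ for some smooth functions $\alpha,\beta$ on $V$ with $\beta>0$. 2. (Degenerate case $r=1$, including Kerr–Schild vector fields.) There is a nowhere vanishing null vector field on $V$ whose associated 1-form $k$ satisfies $$\pounds_\xi g=\alpha g+\beta\,k\otimes k,\qquad \pounds_\xi k=\gamma k$$ for some smooth functions $\alpha,\beta,\gamma$ on $V$ with $\beta>0$. Then $\xi$ generates a one-parameter submonoid of causal symmetries: for every $s>0$ the tensor $\varphi_s^*g$ is causal wherever $\varphi_s$ is defined; for every $s\ge 0$ the differential $\varphi_s'$ maps future-directed causal vectors to future-directed causal vectors wherever $\varphi_s$ is defined; every $\varphi_s$ with $s\ge0$ that is a diffeomorphism of $V$ onto itself is a causal symmetry; and if $\xi$ is complete, then $s\mapsto\varphi_s$ is a monoid homomorphism from $([0,\infty),+)$ to the monoid of causal symmetries. -/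

import Mathlib

open scoped Manifold ContDiff NNReal

namespace CausalSym

noncomputable section

/-- A smooth Lorentzian metric of signature `(+,-,…,-)` on a manifold `V` modelled on `E`:
a smooth symmetric bilinear form on the tangent spaces which, at each point, is positive on some
vector and negative definite on the orthogonal complement of that vector. -/
structure LorentzMetric (E : Type*) [NormedAddCommGroup E] [NormedSpace ℝ E]
    (V : Type*) [TopologicalSpace V] [ChartedSpace E V] [IsManifold 𝓘(ℝ, E) ∞ V] where
  val (p : V) : TangentSpace 𝓘(ℝ, E) p →L[ℝ] TangentSpace 𝓘(ℝ, E) p →L[ℝ] ℝ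
  symm (p : V) (u v : TangentSpace 𝓘(ℝ, E) p) : val p u v = val p v u
  signature (p : V) : ∃ t : TangentSpace 𝓘(ℝ, E) p, 0 < val p t t ∧
    ∀ v : TangentSpace 𝓘(ℝ, E) p, val p t v = 0 → v ≠ 0 → val p v v < 0
  smooth : ContMDiff 𝓘(ℝ, E) (𝓘(ℝ, E).prod 𝓘(ℝ, E →L[ℝ] E →L[ℝ] ℝ)) ∞
    (fun p => Bundle.TotalSpace.mk' (E →L[ℝ] E →L[ℝ] ℝ)
      (E := fun p : V => TangentSpace 𝓘(ℝ, E) p →L[ℝ] TangentSpace 𝓘(ℝ, E) p →L[ℝ] ℝ) p (val p))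

section

variable {E : Type*} [NormedAddCommGroup E] [NormedSpace ℝ E]
  {V : Type*} [TopologicalSpace V] [ChartedSpace E V] [IsManifold 𝓘(ℝ, E) ∞ V]

/-- Smoothness of a vector field, as a section of the tangent bundle. -/
def SmoothField (X : (p : V) → TangentSpace 𝓘(ℝ, E) p) : Prop :=
  ContMDiff 𝓘(ℝ, E) 𝓘(ℝ, E).tangent ∞
    (fun p => (⟨p, X p⟩ : TangentBundle 𝓘(ℝ, E) V))

/-- A causal orientation: a smooth timelike vector field, chosen as future pointing. -/
structure TimeOrientation (g : LorentzMetric E V) where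
  field (p : V) : TangentSpace 𝓘(ℝ, E) p
  smooth : SmoothField field
  timelike (p : V) : 0 < g.val p (field p) (field p)

/-- `Θ⁺` at the point `p`: the future-directed causal vectors. -/
def future (g : LorentzMetric E V) (o : TimeOrientation g) (p : V) :
    Set (TangentSpace 𝓘(ℝ, E) p) :=
  {u | 0 ≤ g.val p u u ∧ 0 < g.val p (o.field p) u}

/-- A bilinear form at `p` is causal future-directed if it is nonnegative on
all pairs of future-directed causal vectors. -/
def IsCausalForm (g : LorentzMetric E V) (o : TimeOrientation g) (p : V)
    (T : TangentSpace 𝓘(ℝ, E) p → TangentSpace 𝓘(ℝ, E) p → ℝ) : Prop :=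
  ∀ u ∈ future g o p, ∀ v ∈ future g o p, 0 ≤ T u v

/-- The monoid of causal symmetries: the diffeomorphisms of `V` whose differential maps
future-directed causal vectors to future-directed causal vectors. It is realised as a submonoid
of the group of bijections of `V` under composition. -/
def causalSymmetries (g : LorentzMetric E V) (o : TimeOrientation g) :
    Submonoid (Equiv.Perm V) where
  carrier := {f | ContMDiff 𝓘(ℝ, E) 𝓘(ℝ, E) ∞ f ∧ ContMDiff 𝓘(ℝ, E) 𝓘(ℝ, E) ∞ f.symm ∧
    ∀ p : V, ∀ u ∈ future g o p,
      mfderiv 𝓘(ℝ, E) 𝓘(ℝ, E) f p u ∈ future g o (f p)}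
  one_mem' := by
    refine ⟨contMDiff_id, contMDiff_id, fun p u hu => ?_⟩
    have h : mfderiv 𝓘(ℝ, E) 𝓘(ℝ, E) ((1 : Equiv.Perm V) : V → V) p
        = ContinuousLinearMap.id ℝ (TangentSpace 𝓘(ℝ, E) p) := mfderiv_id
    rw [h]
    exact hu
  mul_mem' := by
    rintro a b ⟨ha, ha', hfa⟩ ⟨hb, hb', hfb⟩
    refine ⟨ha.comp hb, hb'.comp ha', fun p u hu => ?_⟩
    have h : mfderiv 𝓘(ℝ, E) 𝓘(ℝ, E) ((a * b : Equiv.Perm V) : V → V) p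
        = (mfderiv 𝓘(ℝ, E) 𝓘(ℝ, E) a (b p)).comp (mfderiv 𝓘(ℝ, E) 𝓘(ℝ, E) b p) :=
      mfderiv_comp p (ha.mdifferentiableAt (by simp)) (hb.mdifferentiableAt (by simp))
    rw [h]
    exact hfa (b p) _ (hfb p u hu)

/-- `φ` is a local one-parameter group with infinitesimal generator `ξ`, where `φ s p` is
meaningful for `(s, p)` in the open set `D`, which contains `{0} × V` and meets each line
`ℝ × {p}` in an interval. The generator is complete, with globally defined flow, when `D` can be
taken to be the whole of `ℝ × V`. -/
structure IsLocalFlow (ξ : (p : V) → TangentSpace 𝓘(ℝ, E) p) (D : Set (ℝ × V))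
    (φ : ℝ → V → V) : Prop where
  isOpen : IsOpen D
  zero_mem (p : V) : ((0 : ℝ), p) ∈ D
  interval (p : V) : {s : ℝ | (s, p) ∈ D}.OrdConnected
  smooth : ContMDiffOn (𝓘(ℝ, ℝ).prod 𝓘(ℝ, E)) 𝓘(ℝ, E) ∞ (fun x : ℝ × V => φ x.1 x.2) D
  map_zero (p : V) : φ 0 p = p
  map_add (s t : ℝ) (p : V) : (t, p) ∈ D → (s, φ t p) ∈ D → (s + t, p) ∈ D →
    φ s (φ t p) = φ (s + t) p
  generator (p : V) : IsMIntegralCurveOn (fun s => φ s p) ξ {s : ℝ | (s, p) ∈ D}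

/-- The pull-back `f^* θ` of a one-form. -/
def pullbackOne (f : V → V) (θ : (p : V) → TangentSpace 𝓘(ℝ, E) p → ℝ) (p : V)
    (u : TangentSpace 𝓘(ℝ, E) p) : ℝ :=
  θ (f p) (mfderiv 𝓘(ℝ, E) 𝓘(ℝ, E) f p u)

/-- The pull-back `f^* T` of a two-covariant tensor field. -/
def pullbackTwo (f : V → V)
    (T : (p : V) → TangentSpace 𝓘(ℝ, E) p → TangentSpace 𝓘(ℝ, E) p → ℝ) (p : V)
    (u v : TangentSpace 𝓘(ℝ, E) p) : ℝ :=
  T (f p) (mfderiv 𝓘(ℝ, E) 𝓘(ℝ, E) f p u) (mfderiv 𝓘(ℝ, E) 𝓘(ℝ, E) f p v)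

/-- The Lie derivative of the one-form `θ` along the generator of `φ` exists at every point and
equals `θ'`, the Lie derivative being `d/ds (φ_s^* θ)` at `s = 0`. -/
def HasLieDerivOne (φ : ℝ → V → V) (θ θ' : (p : V) → TangentSpace 𝓘(ℝ, E) p → ℝ) : Prop :=
  ∀ (p : V) (u : TangentSpace 𝓘(ℝ, E) p),
    HasDerivAt (fun s : ℝ => pullbackOne (φ s) θ p u) (θ' p u) 0

/-- The Lie derivative of the two-covariant tensor field `T` along the generator of `φ` exists at
every point and equals `T'`. -/
def HasLieDerivTwo (φ : ℝ → V → V)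
    (T T' : (p : V) → TangentSpace 𝓘(ℝ, E) p → TangentSpace 𝓘(ℝ, E) p → ℝ) : Prop :=
  ∀ (p : V) (u v : TangentSpace 𝓘(ℝ, E) p),
    HasDerivAt (fun s : ℝ => pullbackTwo (φ s) T p u v) (T' p u v) 0

/-- The local flow `φ` consists, for positive parameter, of causal symmetries.

* `φ_s^* g` is a causal tensor wherever `φ_s` is defined, `s > 0`;
* `φ_s` maps future-directed causal vectors to future-directed causal vectors wherever it is
  defined, `s ≥ 0`;
* each `φ_s`, `s ≥ 0`, that is a (globally defined) diffeomorphism of `V` is a causal symmetry;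
* if the flow is global, then `s ↦ φ_s` is a homomorphism from the half-line `(ℝ≥0, +)` to the
  monoid of causal symmetries. -/
structure GeneratesCausalSubmonoid (g : LorentzMetric E V) (o : TimeOrientation g)
    (D : Set (ℝ × V)) (φ : ℝ → V → V) : Prop where
  pullback_causal (s : ℝ) (p : V) : (s, p) ∈ D → 0 < s →
    IsCausalForm g o p (pullbackTwo (φ s) (fun q u v => g.val q u v) p)
  map_future (s : ℝ) (p : V) : (s, p) ∈ D → 0 ≤ s → ∀ u ∈ future g o p,
    mfderiv 𝓘(ℝ, E) 𝓘(ℝ, E) (φ s) p u ∈ future g o (φ s p)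
  diffeo_mem (s : ℝ) (f : Diffeomorph 𝓘(ℝ, E) 𝓘(ℝ, E) V V ∞) : 0 ≤ s →
    (∀ p : V, (s, p) ∈ D ∧ f p = φ s p) → f.toEquiv ∈ causalSymmetries g o
  submonoid : D = Set.univ → ∃ F : Multiplicative ℝ≥0 →* causalSymmetries g o,
    ∀ (s : ℝ≥0) (p : V), (F (Multiplicative.ofAdd s) : Equiv.Perm V) p = φ (s : ℝ) p

/-! ### Superenergy tensors -/

/-- The `r`-form `k₁ ∧ … ∧ k_r` at `p`, where `k_i` also denotes the one-form `g(k_i, ·)`. -/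
def wedge (g : LorentzMetric E V) (p : V) {r : ℕ} (k : Fin r → TangentSpace 𝓘(ℝ, E) p) :
    (TangentSpace 𝓘(ℝ, E) p) [⋀^Fin r]→ₗ[ℝ] ℝ :=
  (Matrix.detRowAlternating (n := Fin r) (R := ℝ)).compLinearMap
    (LinearMap.pi fun i => (g.val p (k i)).toLinearMap)

/-- The `i`-th vector `b_i` of a fixed basis of the tangent space at `p`. -/
def basisVec (E : Type*) [NormedAddCommGroup E] [NormedSpace ℝ E] [FiniteDimensional ℝ E]
    {V : Type*} [TopologicalSpace V] [ChartedSpace E V] (p : V)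
    (i : Fin (Module.finrank ℝ E)) : TangentSpace 𝓘(ℝ, E) p :=
  (Module.finBasis ℝ E i : E)

variable [FiniteDimensional ℝ E]

/-- The components `g_{ij}` of the metric at `p`. -/
def gram (g : LorentzMetric E V) (p : V) :
    Matrix (Fin (Module.finrank ℝ E)) (Fin (Module.finrank ℝ E)) ℝ :=
  Matrix.of fun i j => g.val p (basisVec E p i) (basisVec E p j)

/-- The basis vector with index raised, `b^i = g^{ij} b_j`. -/
def raisedVec (g : LorentzMetric E V) (p : V) (i : Fin (Module.finrank ℝ E)) :
    TangentSpace 𝓘(ℝ, E) p :=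
  ∑ j, (gram g p)⁻¹ i j • basisVec E p j

/-- `Ω_{a c₁…c_m} Ω_b{}^{c₁…c_m} u^a v^b` for an `(m+1)`-form `Ω`. -/
def contractTail (g : LorentzMetric E V) (p : V) {m : ℕ}
    (Ω : (TangentSpace 𝓘(ℝ, E) p) [⋀^Fin (m + 1)]→ₗ[ℝ] ℝ)
    (u v : TangentSpace 𝓘(ℝ, E) p) : ℝ :=
  ∑ c : Fin m → Fin (Module.finrank ℝ E),
    Ω (Fin.cons u fun i => basisVec E p (c i)) * Ω (Fin.cons v fun i => raisedVec g p (c i))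

/-- The full contraction `Ω · Ω = Ω_{c₁…c_r} Ω^{c₁…c_r}`. -/
def selfContract (g : LorentzMetric E V) (p : V) {r : ℕ}
    (Ω : (TangentSpace 𝓘(ℝ, E) p) [⋀^Fin r]→ₗ[ℝ] ℝ) : ℝ :=
  ∑ c : Fin r → Fin (Module.finrank ℝ E),
    Ω (fun i => basisVec E p (c i)) * Ω (fun i => raisedVec g p (c i))

/-- The superenergy tensor of an `r`-form `Ω`, `r = m + 1`:
`T_{ab} = (-1)^{r-1}/(r-1)! (Ω_{a c₂…c_r} Ω_b{}^{c₂…c_r} - (1/(2r)) (Ω · Ω) g_{ab})`. -/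
def superEnergy (g : LorentzMetric E V) (p : V) {m : ℕ}
    (Ω : (TangentSpace 𝓘(ℝ, E) p) [⋀^Fin (m + 1)]→ₗ[ℝ] ℝ)
    (u v : TangentSpace 𝓘(ℝ, E) p) : ℝ :=
  (-1 : ℝ) ^ m / (m.factorial : ℝ) *
    (contractTail g p Ω u v - 1 / (2 * ((m : ℝ) + 1)) * selfContract g p Ω * g.val p u v)

end

end

end CausalSym

/-! Fix future causal vectors `u`, `v` at `p` and follow the orbit of `p`. In the case `r ≥ 2`, the
functions x(s) = (φ_s^*g)(u,v) and y(s) = (φ_s^*S)(u,v) solve x' = ax + by, y' = bx + ay, where a, b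
are α, β along the orbit. With A, B their integrals, x(s) = e^A (x(0) cosh B + y(0) sinh B) ≥ x(0)
e^A cosh B as soon as y(0) ≥ 0 (`exists_mul_le_of_hyperbolic`). So `S` needs to be causal only at
the starting point. It is: the normalized superenergy tensor is g composed with the reflection in
the span of the null factors (`superEnergy_wedge`), and this span contains a timelike vector
(`isCausalForm_superEnergy`). In the case `r = 1`, the pull-back of the one-form k is a positive
multiple of k at `p`, so the equation for x has a source proportional to k(u)k(v) ≥ 0, and again
x(s) ≥ c x(0) with c > 0. This bound with a strictly positive c suffices
(`generatesCausalSubmonoid_of_le`). The image of a future vector stays causal and nonzero, hence is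
never orthogonal to the time orientation; by continuity it cannot leave the future cone
(`mfderiv_mem_future`). -/

namespace CausalSym

/-! ### Lorentzian linear algebra -/

section Lorentz

variable {X : Type*} [AddCommGroup X] [Module ℝ X] {B : X →ₗ[ℝ] X →ₗ[ℝ] ℝ}

/-- A symmetric bilinear form of signature `(+,-,…,-)`. -/
structure IsLorentz (B : X →ₗ[ℝ] X →ₗ[ℝ] ℝ) : Prop where
  symm (u v : X) : B u v = B v u
  signature : ∃ t : X, 0 < B t t ∧ ∀ v : X, B t v = 0 → v ≠ 0 → B v v < 0

namespace IsLorentz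

/-- Transfers the signature condition from the one given vector `e` to every timelike `t`: a
combination of `t` and `v` orthogonal to `e` would have nonnegative square if `B v v ≥ 0`. -/
theorem neg_of_orthogonal (hB : IsLorentz B) {t v : X} (ht : 0 < B t t) (htv : B t v = 0)
    (hv : v ≠ 0) : B v v < 0 := by
  obtain ⟨e, he, hneg⟩ := hB.signature
  by_contra hvv
  push Not at hvv
  have hw : B e v • t - B e t • v = 0 := by
    by_contra hw
    have h := hneg (B e v • t - B e t • v) (by simp; ring) hw
    have hvt : B v t = 0 := by rw [hB.symm, htv]
    simp only [map_sub, map_smul, LinearMap.sub_apply, LinearMap.smul_apply, smul_eq_mul, htv,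
      hvt] at h
    nlinarith [mul_nonneg (sq_nonneg (B e t)) hvv, mul_nonneg (sq_nonneg (B e v)) ht.le]
  have h1 : B e v * B t t = 0 := by
    have := congrArg (B t) hw
    simpa [htv] using this
  have h2 : B e v = 0 := by
    rcases mul_eq_zero.1 h1 with h | h
    · exact h
    · exact absurd h ht.ne'
  exact (hneg v h2 hv).not_ge hvv

theorem nonpos_of_orthogonal (hB : IsLorentz B) {t v : X} (ht : 0 < B t t) (htv : B t v = 0) :
    B v v ≤ 0 := by
  by_cases hv : v = 0
  · simp [hv]
  · exact (hB.neg_of_orthogonal ht htv hv).le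

theorem apply_ne_zero (hB : IsLorentz B) {t u : X} (ht : 0 < B t t) (hu : 0 ≤ B u u)
    (hu0 : u ≠ 0) : B t u ≠ 0 := fun h =>
  (hB.neg_of_orthogonal ht h hu0).not_ge hu

theorem eq_zero_of_forall (hB : IsLorentz B) {w : X} (h : ∀ v, B v w = 0) : w = 0 := by
  obtain ⟨e, -, hneg⟩ := hB.signature
  by_contra hw
  exact (hneg w (h e) hw).ne (h w)

/-- The combination of `u` and `v` orthogonal to `t` has nonpositive square; expanding it isolates
`B u v` with the coefficient `-2 * B t u * B t v`. -/
theorem nonneg_of_future (hB : IsLorentz B) {t u v : X} (ht : 0 < B t t) (hu : 0 ≤ B u u)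
    (htu : 0 < B t u) (hv : 0 ≤ B v v) (htv : 0 < B t v) : 0 ≤ B u v := by
  have h := hB.nonpos_of_orthogonal (v := B t v • u - B t u • v) ht (by simp; ring)
  simp only [map_sub, map_smul, LinearMap.sub_apply, LinearMap.smul_apply, smul_eq_mul,
    hB.symm v u] at h
  by_contra hneg
  push Not at hneg
  nlinarith [mul_nonneg (sq_nonneg (B t v)) hu, mul_nonneg (sq_nonneg (B t u)) hv,
    mul_pos (mul_pos htu htv) (neg_pos.2 hneg)]

/-- A causal vector has a constant sign on the future cone, so its square is causal. -/
theorem mul_nonneg_of_causal (hB : IsLorentz B) {t k u v : X} (ht : 0 < B t t)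
    (hk : 0 ≤ B k k) (hu : 0 ≤ B u u) (htu : 0 < B t u) (hv : 0 ≤ B v v) (htv : 0 < B t v) :
    0 ≤ B k u * B k v := by
  by_cases hk0 : k = 0
  · simp [hk0]
  rcases lt_or_gt_of_ne (hB.apply_ne_zero ht hk hk0) with h | h
  · have h1 := hB.nonneg_of_future (u := -k) ht (by simpa using hk) (by simpa using h) hu htu
    have h2 := hB.nonneg_of_future (u := -k) ht (by simpa using hk) (by simpa using h) hv htv
    simp only [map_neg, LinearMap.neg_apply] at h1 h2
    nlinarith
  · exact mul_nonneg (hB.nonneg_of_future ht hk h hu htu) (hB.nonneg_of_future ht hk h hv htv)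

/-- The reflection in a subspace containing a timelike vector preserves the future cone:
`u = a + b` is decomposed into the component `a` along the subspace and the component `b`
orthogonal to it, and `e` is a timelike vector of the subspace. -/
theorem reflection_nonneg (hB : IsLorentz B) {t e a b v : X} (ht : 0 < B t t) (he : 0 < B e e)
    (heb : B e b = 0) (hab : B a b = 0) (hu : 0 ≤ B (a + b) (a + b)) (htu : 0 < B t (a + b))
    (hv : 0 ≤ B v v) (htv : 0 < B t v) : 0 ≤ B (a - b) v := by
  have hba : B b a = 0 := by rw [hB.symm, hab]
  have hbb := hB.nonpos_of_orthogonal he heb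
  have hsum : B (a + b) (a + b) = B a a + B b b := by simp [hab, hba]
  have hR : 0 ≤ B (a - b) (a - b) := by simpa [hab, hba] using (hsum ▸ hu)
  refine hB.nonneg_of_future ht hR ?_ hv htv
  by_cases hb : b = 0
  · simpa [hb] using htu
  have hbb' := hB.neg_of_orthogonal he heb hb
  -- This equals `B u u - 2 * B b b` with u = a + b; its strict sign rules out a past-directed
  -- reflected vector.
  have hRu : 0 < B (a - b) (a + b) := by
    simp only [map_sub, map_add, LinearMap.sub_apply, hab, hba]
    linarith
  have hne : a - b ≠ 0 := fun h => by simp [h] at hRu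
  rcases lt_or_gt_of_ne (hB.apply_ne_zero ht hR hne) with h | h
  · have := hB.nonneg_of_future (u := -(a - b)) ht (by simpa [hab, hba, add_comm] using hR)
      (by rw [map_neg]; linarith) hu htu
    rw [map_neg, LinearMap.neg_apply] at this
    linarith
  · exact h

end IsLorentz

end Lorentz

/-! ### Contractions of the wedge product of one-forms -/

section Contraction

open Finset

variable {X : Type*} [AddCommGroup X] [Module ℝ X]

/-- The form `det (B (k i) (x j))`. -/
noncomputable def wedgeForm (B : X →ₗ[ℝ] X →ₗ[ℝ] ℝ) {r : ℕ} (k : Fin r → X) :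
    X [⋀^Fin r]→ₗ[ℝ] ℝ :=
  (Matrix.detRowAlternating (n := Fin r) (R := ℝ)).compLinearMap
    (LinearMap.pi fun i => B (k i))

theorem wedgeForm_apply (B : X →ₗ[ℝ] X →ₗ[ℝ] ℝ) {r : ℕ} (k x : Fin r → X) :
    wedgeForm B k x = ∑ σ : Equiv.Perm (Fin r),
      ((Equiv.Perm.sign σ : ℤ) : ℝ) * ∏ i, B (k (σ i)) (x i) := by
  change Matrix.det (Matrix.of fun i j => B (k j) (x i)) = _
  rw [← Matrix.det_transpose, Matrix.det_apply']
  rfl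

/-- The Gram matrix of a family of vectors. -/
def gramMatrix (B : X →ₗ[ℝ] X →ₗ[ℝ] ℝ) {r : ℕ} (k : Fin r → X) : Matrix (Fin r) (Fin r) ℝ :=
  Matrix.of fun i j => B (k i) (k j)

theorem wedgeForm_self (B : X →ₗ[ℝ] X →ₗ[ℝ] ℝ) {r : ℕ} (k : Fin r → X) :
    wedgeForm B k k = (gramMatrix B k).det := by
  change Matrix.det (Matrix.of fun i j => B (k j) (k i)) = _
  rw [← Matrix.det_transpose]
  rfl

theorem wedgeForm_perm (B : X →ₗ[ℝ] X →ₗ[ℝ] ℝ) {r : ℕ} (k : Fin r → X)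
    (σ : Equiv.Perm (Fin r)) :
    wedgeForm B k (fun i => k (σ i)) =
      ((Equiv.Perm.sign σ : ℤ) : ℝ) * (gramMatrix B k).det := by
  have := (wedgeForm B k).map_perm k σ
  rw [← wedgeForm_self]
  change wedgeForm B k (k ∘ σ) = _
  rw [this, Units.smul_def, zsmul_eq_mul]

/-- Contracting a multilinear map with a product of one-forms, through dual bases. -/
theorem sum_prod_mul_multilinear {ι : Type*} [Fintype ι] (B : X →ₗ[ℝ] X →ₗ[ℝ] ℝ) {b d : ι → X}
    (hbd : ∀ w, ∑ i, B w (b i) • d i = w) {m : ℕ}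
    (T : MultilinearMap ℝ (fun _ : Fin m => X) ℝ) (w : Fin m → X) :
    ∑ c : Fin m → ι, (∏ j, B (w j) (b (c j))) * T (fun j => d (c j)) = T w := by
  classical
  conv_rhs => rw [show w = fun j => ∑ i, B (w j) (b i) • d i from funext fun j => (hbd _).symm]
  rw [MultilinearMap.map_sum]
  refine Finset.sum_congr rfl fun c _ => ?_
  rw [MultilinearMap.map_smul_univ, smul_eq_mul]

/-- Only the first factor is expanded by Leibniz. Contracting its term σ inserts `k ∘ σ` into the
second factor, the two signs cancel, and r! equal terms remain. -/
theorem sum_wedgeForm_mul {ι : Type*} [Fintype ι] (B : X →ₗ[ℝ] X →ₗ[ℝ] ℝ) {b d : ι → X}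
    (hbd : ∀ w, ∑ i, B w (b i) • d i = w) {r : ℕ} (k : Fin r → X) :
    ∑ c : Fin r → ι, wedgeForm B k (fun i => b (c i)) * wedgeForm B k (fun i => d (c i)) =
      (r.factorial : ℝ) * (gramMatrix B k).det := by
  simp only [wedgeForm_apply B k (fun i => b _), sum_mul]
  rw [sum_comm]
  have h : ∀ σ : Equiv.Perm (Fin r), ∑ c : Fin r → ι,
      ((Equiv.Perm.sign σ : ℤ) : ℝ) * (∏ i, B (k (σ i)) (b (c i))) *
        wedgeForm B k (fun i => d (c i)) = (gramMatrix B k).det := by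
    intro σ
    simp only [mul_assoc]
    rw [← mul_sum]
    have := sum_prod_mul_multilinear B hbd (wedgeForm B k).toMultilinearMap (fun i => k (σ i))
    simp only [AlternatingMap.coe_multilinearMap] at this
    rw [this, wedgeForm_perm, ← mul_assoc, ← Int.cast_mul, ← Units.val_mul, Int.units_mul_self]
    simp
  rw [sum_congr rfl fun σ _ => h σ]
  simp [Finset.card_univ, Fintype.card_perm]

/-- By linearity in the first slot: `q` is annihilated by all factors, and every `k j` with `j ≠ σ
0` repeats a later entry. -/
theorem wedgeForm_cons_perm (B : X →ₗ[ℝ] X →ₗ[ℝ] ℝ) {m : ℕ} (k : Fin (m + 1) → X)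
    (σ : Equiv.Perm (Fin (m + 1))) (x : Fin (m + 1) → ℝ) {q : X} (hq : ∀ i, B (k i) q = 0) :
    wedgeForm B k (Fin.cons (∑ j, x j • k j + q) fun i => k (σ i.succ)) =
      ((Equiv.Perm.sign σ : ℤ) : ℝ) * (x (σ 0) * (gramMatrix B k).det) := by
  let L : X →ₗ[ℝ] ℝ := (wedgeForm B k).toMultilinearMap.toLinearMap
    (Fin.cons 0 fun i => k (σ i.succ)) 0
  have hL : ∀ v, L v = wedgeForm B k (Fin.cons v fun i => k (σ i.succ)) := fun v => by
    simp [L, MultilinearMap.toLinearMap]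
  have hLq : L q = 0 := by
    rw [hL, wedgeForm_apply]
    refine sum_eq_zero fun τ _ => ?_
    rw [Fin.prod_univ_succ, Fin.cons_zero, hq, zero_mul, mul_zero]
  have hL0 : L (k (σ 0)) = ((Equiv.Perm.sign σ : ℤ) : ℝ) * (gramMatrix B k).det := by
    rw [hL, ← wedgeForm_perm]
    congr 1
    funext i
    refine Fin.cases ?_ (fun i => ?_) i <;> simp
  have hLj : ∀ j, j ≠ σ 0 → L (k j) = 0 := fun j hj => by
    obtain ⟨i, rfl⟩ := σ.surjective j
    have hi : i ≠ 0 := fun h => hj (by rw [h])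
    obtain ⟨i, rfl⟩ := Fin.exists_succ_eq.2 hi
    rw [hL]
    exact (wedgeForm B k).map_eq_zero_of_eq _ (i := 0) (j := i.succ) (by simp)
      (Fin.succ_ne_zero i).symm
  rw [← hL, map_add, hLq, add_zero, map_sum, sum_eq_single (σ 0)]
  · rw [map_smul, hL0, smul_eq_mul]; ring
  · intro j _ hj
    rw [map_smul, hLj j hj, smul_zero]
  · simp

theorem sum_perm_apply_zero {m : ℕ} (f : Fin (m + 1) → ℝ) :
    ∑ σ : Equiv.Perm (Fin (m + 1)), f (σ 0) = (m.factorial : ℝ) * ∑ j, f j := by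
  rw [← Equiv.sum_comp Equiv.Perm.decomposeFin.symm, Fintype.sum_prod_type]
  simp [Finset.card_univ, Fintype.card_perm, mul_sum]

/-- As for the full contraction, but the first slot stays free: the term σ depends on σ only through
`σ 0`, so each index is counted m! times. -/
theorem sum_wedgeForm_cons_mul {ι : Type*} [Fintype ι] (B : X →ₗ[ℝ] X →ₗ[ℝ] ℝ) {b d : ι → X}
    (hbd : ∀ w, ∑ i, B w (b i) • d i = w) {m : ℕ} (k : Fin (m + 1) → X) (u : X)
    (x : Fin (m + 1) → ℝ) {q : X} (hq : ∀ i, B (k i) q = 0) :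
    ∑ c : Fin m → ι, wedgeForm B k (Fin.cons u fun i => b (c i)) *
        wedgeForm B k (Fin.cons (∑ j, x j • k j + q) fun i => d (c i)) =
      (m.factorial : ℝ) * (gramMatrix B k).det * B (∑ j, x j • k j) u := by
  set v := ∑ j, x j • k j + q with hv
  simp only [wedgeForm_apply B k (Fin.cons u fun i => b _), sum_mul]
  rw [sum_comm]
  have h : ∀ σ : Equiv.Perm (Fin (m + 1)), ∑ c : Fin m → ι,
      ((Equiv.Perm.sign σ : ℤ) : ℝ) *
        (∏ i, B (k (σ i)) ((Fin.cons u fun i => b (c i) : Fin (m + 1) → X) i)) *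
        wedgeForm B k (Fin.cons v fun i => d (c i)) =
      (gramMatrix B k).det * (x (σ 0) * B (k (σ 0)) u) := by
    intro σ
    let T : MultilinearMap ℝ (fun _ : Fin m => X) ℝ :=
      (wedgeForm B k).toMultilinearMap.curryLeft v
    have hT : ∀ y : Fin m → X, T y = wedgeForm B k (Fin.cons v y) := fun y => rfl
    have := sum_prod_mul_multilinear B hbd T (fun i => k (σ i.succ))
    simp only [hT] at this
    simp only [Fin.prod_univ_succ, Fin.cons_zero, Fin.cons_succ, mul_assoc]
    rw [← mul_sum, ← mul_sum, this, hv, wedgeForm_cons_perm B k σ x hq]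
    have hs : ((Equiv.Perm.sign σ : ℤ) : ℝ) * ((Equiv.Perm.sign σ : ℤ) : ℝ) = 1 := by
      rw [← Int.cast_mul, ← Units.val_mul, Int.units_mul_self]; simp
    linear_combination (B (k (σ 0)) u * x (σ 0) * (gramMatrix B k).det) * hs
  rw [sum_congr rfl fun σ _ => h σ, ← mul_sum,
    sum_perm_apply_zero fun j => x j * B (k j) u]
  simp only [map_sum, map_smul, LinearMap.sum_apply, LinearMap.smul_apply, smul_eq_mul]
  ring

theorem exists_decomposition_of_gramMatrix_det_ne_zero {B : X →ₗ[ℝ] X →ₗ[ℝ] ℝ} {r : ℕ}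
    {k : Fin r → X} (h : (gramMatrix B k).det ≠ 0) (v : X) :
    ∃ (x : Fin r → ℝ) (q : X), (∀ i, B (k i) q = 0) ∧ v = ∑ j, x j • k j + q := by
  have hu : IsUnit (gramMatrix B k).det := isUnit_iff_ne_zero.2 h
  -- Coefficients of the orthogonal projection onto the span of `k`.
  let x := (gramMatrix B k)⁻¹.mulVec fun i => B (k i) v
  refine ⟨x, v - ∑ j, x j • k j, fun i => ?_, by abel⟩
  have : (gramMatrix B k).mulVec x = fun i => B (k i) v := by
    simp only [x, Matrix.mulVec_mulVec, Matrix.mul_nonsing_inv _ hu, Matrix.one_mulVec]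
  have hi := congrFun this i
  simp only [Matrix.mulVec, dotProduct, gramMatrix, Matrix.of_apply] at hi
  rw [map_sub, map_sum, ← hi]
  simp [mul_comm]

theorem exists_timelike_span {B : X →ₗ[ℝ] X →ₗ[ℝ] ℝ} (hB : ∀ u v, B u v = B v u) {m : ℕ}
    {k : Fin (m + 1) → X} (hk : ∀ i, B (k i) (k i) = 0) (h : (gramMatrix B k).det ≠ 0) :
    ∃ e, 0 < B e e ∧ ∀ q, (∀ i, B (k i) q = 0) → B e q = 0 := by
  have : ∃ j, B (k 0) (k j) ≠ 0 := by
    by_contra hz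
    push Not at hz
    exact h (Matrix.det_eq_zero_of_row_eq_zero 0 hz)
  obtain ⟨j, hj⟩ := this
  -- For null vectors with c = `B (k 0) (k j)` ≠ 0 this sum has square 2c².
  refine ⟨k 0 + B (k 0) (k j) • k j, ?_, fun q hq => by simp [hq]⟩
  have := mul_self_pos.2 hj
  simp only [map_add, map_smul, LinearMap.add_apply, LinearMap.smul_apply, smul_eq_mul, hk,
    hB (k j) (k 0)]
  linarith

end Contraction

/-! ### Linear differential equations on an interval -/

section ODE

open Set

theorem exists_antiderivative {f : ℝ → ℝ} {T : ℝ} (hT : 0 ≤ T) (hf : ContinuousOn f (Icc 0 T)) :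
    ∃ F : ℝ → ℝ, F 0 = 0 ∧ ∀ t ∈ Icc 0 T, HasDerivWithinAt F (f t) (Icc 0 T) t := by
  -- Constant extension beyond the endpoints makes the integrand continuous on the whole line.
  have hc : Continuous (IccExtend hT ((Icc 0 T).domRestrict f)) :=
    (continuousOn_iff_continuous_domRestrict.1 hf).Icc_extend'
  refine ⟨fun t => ∫ x in (0 : ℝ)..t, IccExtend hT ((Icc 0 T).domRestrict f) x, by simp,
    fun t ht => ?_⟩
  have h := (intervalIntegral.integral_hasDerivAt_right (hc.intervalIntegrable 0 t)
    hc.stronglyMeasurable.stronglyMeasurableAtFilter hc.continuousAt).hasDerivWithinAt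
      (s := Icc 0 T)
  rwa [IccExtend_of_mem hT _ ht] at h

theorem le_of_hasDerivWithinAt_nonneg {y y' : ℝ → ℝ} {T : ℝ} (hT : 0 ≤ T)
    (hy : ∀ t ∈ Icc 0 T, HasDerivWithinAt y (y' t) (Icc 0 T) t)
    (hy' : ∀ t ∈ Icc 0 T, 0 ≤ y' t) : y 0 ≤ y T :=
  monotoneOn_of_hasDerivWithinAt_nonneg (convex_Icc 0 T)
    (fun t ht => (hy t ht).continuousWithinAt)
    (fun t ht => (hy t (interior_subset ht)).mono interior_subset)
    (fun t ht => hy' t (interior_subset ht)) (left_mem_Icc.2 hT) (right_mem_Icc.2 hT) hT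

/-- Integrating factor: y e^{-A} has derivative d e^{-A} ≥ 0. -/
theorem mul_exp_le_of_linear {y a d A : ℝ → ℝ} {T : ℝ} (hT : 0 ≤ T) (hA0 : A 0 = 0)
    (hA : ∀ t ∈ Icc 0 T, HasDerivWithinAt A (a t) (Icc 0 T) t)
    (hy : ∀ t ∈ Icc 0 T, HasDerivWithinAt y (a t * y t + d t) (Icc 0 T) t)
    (hd : ∀ t ∈ Icc 0 T, 0 ≤ d t) : y 0 * Real.exp (A T) ≤ y T := by
  have h := le_of_hasDerivWithinAt_nonneg (y := fun t => y t * Real.exp (-A t))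
    (y' := fun t => d t * Real.exp (-A t)) hT
    (fun t ht => ((hy t ht).mul (hA t ht).neg.exp).congr_deriv (by
      simp only [Pi.neg_apply]; ring))
    (fun t ht => mul_nonneg (hd t ht) (Real.exp_pos _).le)
  simp only [hA0, neg_zero, Real.exp_zero, mul_one] at h
  calc y 0 * Real.exp (A T) ≤ y T * Real.exp (-A T) * Real.exp (A T) :=
        mul_le_mul_of_nonneg_right h (Real.exp_pos _).le
    _ = y T := by rw [mul_assoc, ← Real.exp_add]; simp

theorem eq_mul_exp_of_linear {y a A : ℝ → ℝ} {T : ℝ} (hT : 0 ≤ T) (hA0 : A 0 = 0)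
    (hA : ∀ t ∈ Icc 0 T, HasDerivWithinAt A (a t) (Icc 0 T) t)
    (hy : ∀ t ∈ Icc 0 T, HasDerivWithinAt y (a t * y t) (Icc 0 T) t) :
    y T = y 0 * Real.exp (A T) := by
  refine le_antisymm ?_ ?_
  · have := mul_exp_le_of_linear (y := fun t => -y t) (d := 0) hT hA0 hA
      (fun t ht => (hy t ht).neg.congr_deriv (by simp)) (fun t _ => le_rfl)
    linarith
  · exact mul_exp_le_of_linear (d := 0) hT hA0 hA
      (fun t ht => (hy t ht).congr_deriv (by simp)) (fun t _ => le_rfl)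

/-- The system `x' = a x + b y`, `y' = b x + a y`, `b ≥ 0`, preserves the positive quadrant. -/
theorem exists_mul_le_of_hyperbolic {x y a b : ℝ → ℝ} {T : ℝ} (hT : 0 ≤ T)
    (ha : ContinuousOn a (Icc 0 T)) (hb : ContinuousOn b (Icc 0 T))
    (hb0 : ∀ t ∈ Icc 0 T, 0 ≤ b t)
    (hx : ∀ t ∈ Icc 0 T, HasDerivWithinAt x (a t * x t + b t * y t) (Icc 0 T) t)
    (hy : ∀ t ∈ Icc 0 T, HasDerivWithinAt y (b t * x t + a t * y t) (Icc 0 T) t)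
    (hy0 : 0 ≤ y 0) : ∃ c, 0 < c ∧ x 0 * c ≤ x T := by
  obtain ⟨A, hA0, hA⟩ := exists_antiderivative hT ha
  obtain ⟨B, hB0, hB⟩ := exists_antiderivative hT hb
  have hBT : 0 ≤ B T := hB0 ▸ le_of_hasDerivWithinAt_nonneg hT hB hb0
  have hp := eq_mul_exp_of_linear (y := fun t => x t + y t) (a := fun t => a t + b t)
    (A := fun t => A t + B t) hT (by simp [hA0, hB0]) (fun t ht => (hA t ht).add (hB t ht))
    (fun t ht => ((hx t ht).add (hy t ht)).congr_deriv (by ring))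
  have hm := eq_mul_exp_of_linear (y := fun t => x t - y t) (a := fun t => a t - b t)
    (A := fun t => A t - B t) hT (by simp [hA0, hB0]) (fun t ht => (hA t ht).sub (hB t ht))
    (fun t ht => ((hx t ht).sub (hy t ht)).congr_deriv (by ring))
  -- The sum and difference of `x` and `y` decouple; this constant is e^A cosh B, and the discarded
  -- term y(0) e^A sinh B is nonnegative since B ≥ 0.
  refine ⟨(Real.exp (A T + B T) + Real.exp (A T - B T)) / 2, by positivity, ?_⟩
  have hle : Real.exp (A T - B T) ≤ Real.exp (A T + B T) := Real.exp_le_exp.2 (by linarith)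
  have := mul_nonneg hy0 (sub_nonneg.2 hle)
  linarith

end ODE

/-! ### Local flows and Lie derivatives -/

section Flow

set_option linter.unusedSectionVars false

open Set Filter Topology

variable {E : Type*} [NormedAddCommGroup E] [NormedSpace ℝ E]
  {V : Type*} [TopologicalSpace V] [ChartedSpace E V] [IsManifold 𝓘(ℝ, E) ∞ V]

theorem pullbackOne_congr {f f' : V → V} {p : V} (h : f =ᶠ[𝓝 p] f')
    (θ : (p : V) → TangentSpace 𝓘(ℝ, E) p → ℝ) (u : TangentSpace 𝓘(ℝ, E) p) :
    pullbackOne f θ p u = pullbackOne f' θ p u := by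
  -- Viewing every fibre as `E` lets base point and differential be replaced together, avoiding a
  -- dependent rewrite.
  have key : ∀ (q q' : V) (L L' : E →L[ℝ] E), q = q' → L = L' →
      (θ q : E → ℝ) (L u) = (θ q' : E → ℝ) (L' u) := by
    rintro q _ L _ rfl rfl; rfl
  exact key _ _ _ _ h.self_of_nhds h.mfderiv_eq

theorem pullbackTwo_congr {f f' : V → V} {p : V} (h : f =ᶠ[𝓝 p] f')
    (T : (p : V) → TangentSpace 𝓘(ℝ, E) p → TangentSpace 𝓘(ℝ, E) p → ℝ)
    (u v : TangentSpace 𝓘(ℝ, E) p) : pullbackTwo f T p u v = pullbackTwo f' T p u v := by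
  have key : ∀ (q q' : V) (L L' : E →L[ℝ] E), q = q' → L = L' →
      (T q : E → E → ℝ) (L u) (L v) = (T q' : E → E → ℝ) (L' u) (L' v) := by
    rintro q _ L _ rfl rfl; rfl
  exact key _ _ _ _ h.self_of_nhds h.mfderiv_eq

namespace IsLocalFlow

variable {ξ : (p : V) → TangentSpace 𝓘(ℝ, E) p} {D : Set (ℝ × V)} {φ : ℝ → V → V}

theorem contMDiffAt (hφ : IsLocalFlow ξ D φ) {s : ℝ} {p : V} (h : (s, p) ∈ D) :
    ContMDiffAt (𝓘(ℝ, ℝ).prod 𝓘(ℝ, E)) 𝓘(ℝ, E) ∞ (fun x : ℝ × V => φ x.1 x.2) (s, p) :=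
  hφ.smooth.contMDiffAt (hφ.isOpen.mem_nhds h)

theorem contMDiffAt_right (hφ : IsLocalFlow ξ D φ) {s : ℝ} {p : V} (h : (s, p) ∈ D) :
    ContMDiffAt 𝓘(ℝ, E) 𝓘(ℝ, E) ∞ (φ s) p :=
  ContMDiffAt.comp (f := fun q : V => (s, q)) p (hφ.contMDiffAt h)
    (contMDiffAt_const.prodMk contMDiffAt_id)

theorem mdifferentiableAt_right (hφ : IsLocalFlow ξ D φ) {s : ℝ} {p : V} (h : (s, p) ∈ D) :
    MDifferentiableAt 𝓘(ℝ, E) 𝓘(ℝ, E) (φ s) p :=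
  (hφ.contMDiffAt_right h).mdifferentiableAt (by simp)

theorem contMDiffAt_left (hφ : IsLocalFlow ξ D φ) {s : ℝ} {p : V} (h : (s, p) ∈ D) :
    ContMDiffAt 𝓘(ℝ, ℝ) 𝓘(ℝ, E) ∞ (fun s => φ s p) s :=
  ContMDiffAt.comp (f := fun t : ℝ => (t, p)) s (hφ.contMDiffAt h)
    (contMDiffAt_id.prodMk contMDiffAt_const)

theorem continuousOn_comp (hφ : IsLocalFlow ξ D φ) {f : V → ℝ} (hf : Continuous f) {p : V}
    {I : Set ℝ} (hI : ∀ s ∈ I, (s, p) ∈ D) : ContinuousOn (fun s => f (φ s p)) I :=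
  fun _ hs => (hf.continuousAt.comp
    (hφ.contMDiffAt_left (hI _ hs)).continuousAt).continuousWithinAt

theorem mem_of_mem_Icc (hφ : IsLocalFlow ξ D φ) {s t : ℝ} {p : V} (h : (s, p) ∈ D)
    (ht : t ∈ Icc 0 s) : (t, p) ∈ D :=
  (hφ.interval p).out (hφ.zero_mem p) h ht

/-- The group law is needed as an identity of germs at `p`, so that it can be differentiated in the
space variable; openness of `D` provides it. -/
theorem eventually_map_add (hφ : IsLocalFlow ξ D φ) {s : ℝ} {p : V} (h : (s, p) ∈ D) :
    ∀ᶠ e in 𝓝 (0 : ℝ), (e, φ s p) ∈ D ∧ φ (e + s) =ᶠ[𝓝 p] φ e ∘ φ s := by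
  have h1 : ∀ᶠ x : ℝ × V in 𝓝 (0, p), (s, x.2) ∈ D := by
    have hc : Continuous fun x : ℝ × V => (s, x.2) := by fun_prop
    exact hc.continuousAt.eventually_mem (hφ.isOpen.mem_nhds h)
  have h2 : ∀ᶠ x : ℝ × V in 𝓝 (0, p), (x.1 + s, x.2) ∈ D := by
    have hc : Continuous fun x : ℝ × V => (x.1 + s, x.2) := by fun_prop
    exact hc.continuousAt.eventually_mem (hφ.isOpen.mem_nhds (by simpa using h))
  have h3 : ∀ᶠ x : ℝ × V in 𝓝 (0, p), (x.1, φ s x.2) ∈ D := by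
    have hc : ContinuousAt (fun x : ℝ × V => (x.1, φ s x.2)) (0, p) :=
      continuousAt_fst.prodMk
        (ContinuousAt.comp (f := fun x : ℝ × V => x.2)
          (hφ.contMDiffAt_right h).continuousAt continuousAt_snd)
    exact hc.eventually_mem (hφ.isOpen.mem_nhds (hφ.zero_mem _))
  have h123 := (h1.and (h2.and h3))
  rw [nhds_prod_eq] at h123
  filter_upwards [h123.curry] with e he
  exact ⟨he.self_of_nhds.2.2, he.mono fun q hq => (hφ.map_add e s q hq.1 hq.2.2 hq.2.1).symm⟩

theorem pullbackTwo_zero (hφ : IsLocalFlow ξ D φ)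
    (T : (p : V) → TangentSpace 𝓘(ℝ, E) p → TangentSpace 𝓘(ℝ, E) p → ℝ) (p : V)
    (u v : TangentSpace 𝓘(ℝ, E) p) : pullbackTwo (φ 0) T p u v = T p u v := by
  have h : φ 0 = id := funext hφ.map_zero
  rw [h, pullbackTwo, mfderiv_id]
  rfl

theorem pullbackOne_zero (hφ : IsLocalFlow ξ D φ)
    (θ : (p : V) → TangentSpace 𝓘(ℝ, E) p → ℝ) (p : V)
    (u : TangentSpace 𝓘(ℝ, E) p) : pullbackOne (φ 0) θ p u = θ p u := by
  have h : φ 0 = id := funext hφ.map_zero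
  rw [h, pullbackOne, mfderiv_id]
  rfl

theorem hasDerivAt_pullbackOne (hφ : IsLocalFlow ξ D φ)
    {θ θ' : (p : V) → TangentSpace 𝓘(ℝ, E) p → ℝ} (hθ : HasLieDerivOne φ θ θ') {s : ℝ} {p : V}
    (h : (s, p) ∈ D) (u : TangentSpace 𝓘(ℝ, E) p) :
    HasDerivAt (fun t => pullbackOne (φ t) θ p u) (pullbackOne (φ s) θ' p u) s := by
  have h0 : HasDerivAt (fun e => pullbackOne (φ (e + s)) θ p u) (pullbackOne (φ s) θ' p u) 0 := by
    refine (hθ (φ s p) (mfderiv 𝓘(ℝ, E) 𝓘(ℝ, E) (φ s) p u)).congr_of_eventuallyEq ?_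
    filter_upwards [hφ.eventually_map_add h] with e he
    rw [pullbackOne_congr he.2, pullbackOne, mfderiv_comp p (hφ.mdifferentiableAt_right he.1)
      (hφ.mdifferentiableAt_right h)]
    rfl
  have h1 := HasDerivAt.comp_sub_const s s (by rwa [sub_self])
  refine h1.congr_of_eventuallyEq (.of_forall fun t => ?_)
  change _ = pullbackOne (φ (t - s + s)) θ p u
  rw [sub_add_cancel]

/-- The Lie derivative is a derivative at parameter 0; the group law and the chain rule move it to
parameter `s`. -/
theorem hasDerivAt_pullbackTwo (hφ : IsLocalFlow ξ D φ)
    {T T' : (p : V) → TangentSpace 𝓘(ℝ, E) p → TangentSpace 𝓘(ℝ, E) p → ℝ}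
    (hT : HasLieDerivTwo φ T T') {s : ℝ} {p : V}
    (h : (s, p) ∈ D) (u v : TangentSpace 𝓘(ℝ, E) p) :
    HasDerivAt (fun t => pullbackTwo (φ t) T p u v) (pullbackTwo (φ s) T' p u v) s := by
  have h0 : HasDerivAt (fun e => pullbackTwo (φ (e + s)) T p u v)
      (pullbackTwo (φ s) T' p u v) 0 := by
    refine (hT (φ s p) (mfderiv 𝓘(ℝ, E) 𝓘(ℝ, E) (φ s) p u)
      (mfderiv 𝓘(ℝ, E) 𝓘(ℝ, E) (φ s) p v)).congr_of_eventuallyEq ?_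
    filter_upwards [hφ.eventually_map_add h] with e he
    rw [pullbackTwo_congr he.2, pullbackTwo, mfderiv_comp p (hφ.mdifferentiableAt_right he.1)
      (hφ.mdifferentiableAt_right h)]
    rfl
  have h1 := HasDerivAt.comp_sub_const s s (by rwa [sub_self])
  refine h1.congr_of_eventuallyEq (.of_forall fun t => ?_)
  change _ = pullbackTwo (φ (t - s + s)) T p u v
  rw [sub_add_cancel]

theorem contMDiffAt_mfderiv_apply (hφ : IsLocalFlow ξ D φ) {s : ℝ} {p : V} (h : (s, p) ∈ D)
    (u : TangentSpace 𝓘(ℝ, E) p) :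
    ContMDiffAt 𝓘(ℝ, ℝ) 𝓘(ℝ, E).tangent ∞
      (fun t => (⟨φ t p, mfderiv 𝓘(ℝ, E) 𝓘(ℝ, E) (φ t) p u⟩ : TangentBundle 𝓘(ℝ, E) V)) s := by
  have h1 := ContMDiffAt.mfderiv (I := 𝓘(ℝ, E)) (I' := 𝓘(ℝ, E)) (J := 𝓘(ℝ, ℝ)) (m := ∞) (n := ∞)
    φ (fun _ : ℝ => p) (x₀ := s) (hφ.contMDiffAt h) contMDiffAt_const (by simp)
  exact ContMDiffAt.clm_apply_of_inCoordinates (F₁ := E) (F₂ := E)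
    (E₁ := fun q : V => TangentSpace 𝓘(ℝ, E) q) (E₂ := fun q : V => TangentSpace 𝓘(ℝ, E) q)
    (b₁ := fun _ : ℝ => p) (b₂ := fun t => φ t p) (v := fun _ => u)
    (IB₁ := 𝓘(ℝ, E)) (IB₂ := 𝓘(ℝ, E)) (m₀ := s)
    (ϕ := fun t => mfderiv 𝓘(ℝ, E) 𝓘(ℝ, E) (φ t) p) h1 contMDiffAt_const
    (hφ.contMDiffAt_left h)

/-- The scalar product of a smooth field with a vector dragged along by the flow is continuous. -/
theorem continuousAt_inner_mfderiv (hφ : IsLocalFlow ξ D φ) (g : LorentzMetric E V)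
    {X : (p : V) → TangentSpace 𝓘(ℝ, E) p} (hX : SmoothField X) {s : ℝ} {p : V}
    (h : (s, p) ∈ D) (u : TangentSpace 𝓘(ℝ, E) p) :
    ContinuousAt (fun t => g.val (φ t p) (X (φ t p))
      (mfderiv 𝓘(ℝ, E) 𝓘(ℝ, E) (φ t) p u)) s := by
  have hl := hφ.contMDiffAt_left h
  have h1 := ContMDiffAt.clm_bundle_apply₂ (F₁ := E) (F₂ := E) (F₃ := ℝ)
    (E₁ := fun q : V => TangentSpace 𝓘(ℝ, E) q) (E₂ := fun q : V => TangentSpace 𝓘(ℝ, E) q)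
    (E₃ := fun _ : V => ℝ)
    (ψ := fun t => g.val (φ t p)) (b := fun t => φ t p) (v := fun t => X (φ t p))
    (w := fun t => mfderiv 𝓘(ℝ, E) 𝓘(ℝ, E) (φ t) p u)
    (ContMDiffAt.comp s g.smooth.contMDiffAt hl) (ContMDiffAt.comp s hX.contMDiffAt hl)
    (hφ.contMDiffAt_mfderiv_apply h u)
  exact (Bundle.contMDiffAt_totalSpace.1 h1).2.continuousAt

end IsLocalFlow

end Flow

/-! ### The metric and its future cones -/

section Geometry

variable {E : Type*} [NormedAddCommGroup E] [NormedSpace ℝ E]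
  {V : Type*} [TopologicalSpace V] [ChartedSpace E V] [IsManifold 𝓘(ℝ, E) ∞ V]

/-- The metric at a point as an algebraic bilinear form. -/
noncomputable def LorentzMetric.bilin (g : LorentzMetric E V) (p : V) :
    TangentSpace 𝓘(ℝ, E) p →ₗ[ℝ] TangentSpace 𝓘(ℝ, E) p →ₗ[ℝ] ℝ :=
  (g.val p).toLinearMap₁₂

theorem LorentzMetric.isLorentz (g : LorentzMetric E V) (p : V) : IsLorentz (g.bilin p) where
  symm := g.symm p
  signature := g.signature p

theorem field_mem_future (g : LorentzMetric E V) (o : TimeOrientation g) (p : V) :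
    o.field p ∈ future g o p :=
  ⟨(o.timelike p).le, o.timelike p⟩

theorem nonneg_of_mem_future {g : LorentzMetric E V} {o : TimeOrientation g} {p : V}
    {u v : TangentSpace 𝓘(ℝ, E) p} (hu : u ∈ future g o p) (hv : v ∈ future g o p) :
    0 ≤ g.val p u v :=
  (g.isLorentz p).nonneg_of_future (o.timelike p) hu.1 hu.2 hv.1 hv.2

/-! ### Causality of the superenergy tensor -/

section SuperEnergy

variable [FiniteDimensional ℝ E]

theorem isUnit_gram_det (g : LorentzMetric E V) (p : V) : IsUnit (gram g p).det := by
  rw [isUnit_iff_ne_zero]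
  intro h
  obtain ⟨x, hx, hx0⟩ := Matrix.exists_mulVec_eq_zero_iff.2 h
  let b : Module.Basis (Fin (Module.finrank ℝ E)) ℝ (TangentSpace 𝓘(ℝ, E) p) :=
    Module.finBasis ℝ E
  let w : TangentSpace 𝓘(ℝ, E) p := ∑ j, x j • b j
  have hw : ∀ v, g.bilin p v w = 0 := fun v => by
    have : (g.bilin p).flip w = 0 := b.ext fun i => by
      have hi := congrFun hx0 i
      simp only [Matrix.mulVec, dotProduct, gram, Matrix.of_apply, Pi.zero_apply] at hi
      have he : g.bilin p (b i) w = ∑ j, x j * g.bilin p (b i) (b j) := by simp [w]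
      change g.bilin p (b i) w = 0
      rw [he, ← hi]
      exact Finset.sum_congr rfl fun j _ => mul_comm (x j) _
    exact LinearMap.congr_fun this v
  have hw0 : w = 0 := (g.isLorentz p).eq_zero_of_forall hw
  exact hx (funext (Fintype.linearIndependent_iff.1 b.linearIndependent x hw0))

/-- Supplies the dual-basis hypothesis of the abstract contraction lemmas. -/
theorem sum_smul_raisedVec (g : LorentzMetric E V) (p : V) (w : TangentSpace 𝓘(ℝ, E) p) :
    ∑ i, g.bilin p w (basisVec E p i) • raisedVec g p i = w := by
  let b : Module.Basis (Fin (Module.finrank ℝ E)) ℝ (TangentSpace 𝓘(ℝ, E) p) :=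
    Module.finBasis ℝ E
  let L : TangentSpace 𝓘(ℝ, E) p →ₗ[ℝ] TangentSpace 𝓘(ℝ, E) p :=
    ∑ i, ((g.bilin p).flip (basisVec E p i)).smulRight (raisedVec g p i)
  have hL : ∀ w, L w = ∑ i, g.bilin p w (basisVec E p i) • raisedVec g p i := fun w => by
    simp [L]
  rw [← hL]
  refine LinearMap.congr_fun (g := LinearMap.id) (b.ext fun l => ?_) w
  have hmul : ∀ j, ∑ i, gram g p l i * (gram g p)⁻¹ i j = (1 : Matrix _ _ ℝ) l j := fun j => by
    rw [← Matrix.mul_apply, Matrix.mul_nonsing_inv _ (isUnit_gram_det g p)]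
  rw [hL]
  change ∑ i, gram g p l i • ∑ j, (gram g p)⁻¹ i j • b j = b l
  simp only [Finset.smul_sum, smul_smul]
  rw [Finset.sum_comm]
  simp only [← Finset.sum_smul, hmul, Matrix.one_apply, ite_smul, one_smul, zero_smul]
  simp

theorem selfContract_wedge (g : LorentzMetric E V) (p : V) {r : ℕ}
    (k : Fin r → TangentSpace 𝓘(ℝ, E) p) :
    selfContract g p (wedge g p k) = (r.factorial : ℝ) * (gramMatrix (g.bilin p) k).det :=
  sum_wedgeForm_mul (g.bilin p) (sum_smul_raisedVec g p) k

/-- The normalized superenergy tensor of a simple form of null factors is the reflection in the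
subspace spanned by the factors. -/
theorem superEnergy_wedge (g : LorentzMetric E V) (p : V) {m : ℕ}
    {k : Fin (m + 1) → TangentSpace 𝓘(ℝ, E) p}
    (hdet : (gramMatrix (g.bilin p) k).det = 2 * (-1) ^ m) (u : TangentSpace 𝓘(ℝ, E) p)
    (x : Fin (m + 1) → ℝ) {q : TangentSpace 𝓘(ℝ, E) p} (hq : ∀ i, g.bilin p (k i) q = 0) :
    superEnergy g p (wedge g p k) u (∑ j, x j • k j + q) =
      g.bilin p (∑ j, x j • k j - q) u := by
  have hc : contractTail g p (wedge g p k) u (∑ j, x j • k j + q) =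
      (m.factorial : ℝ) * (gramMatrix (g.bilin p) k).det * g.bilin p (∑ j, x j • k j) u :=
    sum_wedgeForm_cons_mul (g.bilin p) (sum_smul_raisedVec g p) k u x hq
  have hg : g.val p u (∑ j, x j • k j + q) =
      g.bilin p (∑ j, x j • k j) u + g.bilin p q u := by
    rw [g.symm]
    exact congrFun (congrArg DFunLike.coe (map_add (g.bilin p) _ _)) u
  rw [superEnergy, hc, selfContract_wedge, hg, hdet, map_sub, LinearMap.sub_apply]
  have hm : (m.factorial : ℝ) ≠ 0 := by positivity
  have hm1 : (m : ℝ) + 1 ≠ 0 := by positivity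
  have hs : ((-1 : ℝ) ^ m) * (-1) ^ m = 1 := by rw [← mul_pow]; simp
  rw [Nat.factorial_succ]
  push_cast
  field_simp
  -- Writing a for the span component, the trace term halves the determinant, and 2(a - (a + q)/2) =
  -- a - q.
  linear_combination (g.bilin p (∑ j, x j • k j) u - g.bilin p q u) * hs

theorem isCausalForm_superEnergy (g : LorentzMetric E V) (o : TimeOrientation g) (p : V) {m : ℕ}
    {k : Fin (m + 1) → TangentSpace 𝓘(ℝ, E) p} (hk : ∀ i, g.val p (k i) (k i) = 0)
    (hn : selfContract g p (wedge g p k) = 2 * ((m + 1).factorial : ℝ) * (-1) ^ m) :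
    IsCausalForm g o p (superEnergy g p (wedge g p k)) := by
  have hdet : (gramMatrix (g.bilin p) k).det = 2 * (-1) ^ m := by
    rw [selfContract_wedge] at hn
    have hm : ((m + 1).factorial : ℝ) ≠ 0 := by positivity
    exact mul_left_cancel₀ hm (by rw [hn]; ring)
  have hdet0 : (gramMatrix (g.bilin p) k).det ≠ 0 := by
    rw [hdet]
    exact mul_ne_zero two_ne_zero (pow_ne_zero _ (by norm_num))
  intro u hu v hv
  obtain ⟨x, q, hq, hvx⟩ := exists_decomposition_of_gramMatrix_det_ne_zero hdet0 v
  obtain ⟨e, he, heq⟩ := exists_timelike_span (g.symm p) (B := g.bilin p) hk hdet0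
  rw [hvx] at hv ⊢
  rw [superEnergy_wedge g p hdet u x hq]
  refine (g.isLorentz p).reflection_nonneg (o.timelike p) he (heq q hq) ?_ hv.1 hv.2 hu.1 hu.2
  simp [hq]

end SuperEnergy

/-! ### Flows of causal symmetries -/

section Generates

variable {g : LorentzMetric E V} {o : TimeOrientation g} {ξ : (p : V) → TangentSpace 𝓘(ℝ, E) p}
  {D : Set (ℝ × V)} {φ : ℝ → V → V}

/-- A local flow is future-preserving if the pull-backs of the metric are bounded below by
positive multiples of the metric on the future cone. -/
theorem mfderiv_mem_future (hφ : IsLocalFlow ξ D φ)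
    (H : ∀ (s : ℝ) (p : V), (s, p) ∈ D → 0 ≤ s → ∀ u ∈ future g o p, ∀ v ∈ future g o p,
      ∃ c, 0 < c ∧ g.val p u v * c ≤ pullbackTwo (φ s) (fun q u v => g.val q u v) p u v)
    {s : ℝ} {p : V} (hs : (s, p) ∈ D) (hs0 : 0 ≤ s) {u : TangentSpace 𝓘(ℝ, E) p}
    (hu : u ∈ future g o p) :
    mfderiv 𝓘(ℝ, E) 𝓘(ℝ, E) (φ s) p u ∈ future g o (φ s p) := by
  have hcausal : ∀ t, (t, p) ∈ D → 0 ≤ t →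
      0 ≤ g.val (φ t p) (mfderiv 𝓘(ℝ, E) 𝓘(ℝ, E) (φ t) p u)
        (mfderiv 𝓘(ℝ, E) 𝓘(ℝ, E) (φ t) p u) := fun t ht ht0 => by
    obtain ⟨c, hc, hle⟩ := H t p ht ht0 u hu u hu
    exact (mul_nonneg hu.1 hc.le).trans hle
  have hne : ∀ t, (t, p) ∈ D → 0 ≤ t → mfderiv 𝓘(ℝ, E) 𝓘(ℝ, E) (φ t) p u ≠ 0 := by
    intro t ht ht0 h0
    -- Pairing with the time orientation makes the lower bound strictly positive, even when `u` is
    -- null.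
    obtain ⟨c, hc, hle⟩ := H t p ht ht0 _ (field_mem_future g o p) u hu
    have := (mul_pos hu.2 hc).trans_le hle
    simp [pullbackTwo, h0] at this
  refine ⟨hcausal s hs hs0, ?_⟩
  let f : ℝ → ℝ := fun t => g.val (φ t p) (o.field (φ t p))
    (mfderiv 𝓘(ℝ, E) 𝓘(ℝ, E) (φ t) p u)
  have hf : ContinuousOn f (Set.Icc 0 s) := fun t ht =>
    (hφ.continuousAt_inner_mfderiv g o.smooth (hφ.mem_of_mem_Icc hs ht) u).continuousWithinAt
  have hf0 : 0 < f 0 := by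
    have h : pullbackOne (φ 0) (fun q v => g.val q (o.field q) v) p u = g.val p (o.field p) u :=
      hφ.pullbackOne_zero (fun q v => g.val q (o.field q) v) p u
    exact hu.2.trans_eq h.symm
  by_contra hneg
  obtain ⟨t, ht, hft⟩ := intermediate_value_Icc' hs0 hf ⟨not_lt.1 hneg, hf0.le⟩
  have htD := hφ.mem_of_mem_Icc hs ht
  exact (g.isLorentz (φ t p)).apply_ne_zero (o.timelike _) (hcausal t htD ht.1)
    (hne t htD ht.1) hft

theorem flow_mem_causalSymmetries {f : Equiv.Perm V} {s : ℝ} (hf : ∀ p, f p = φ s p)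
    (h1 : ContMDiff 𝓘(ℝ, E) 𝓘(ℝ, E) ∞ f) (h2 : ContMDiff 𝓘(ℝ, E) 𝓘(ℝ, E) ∞ f.symm)
    (h : ∀ p, ∀ u ∈ future g o p, mfderiv 𝓘(ℝ, E) 𝓘(ℝ, E) (φ s) p u ∈ future g o (φ s p)) :
    f ∈ causalSymmetries g o := by
  have hfs : φ s = f := (funext hf).symm
  rw [hfs] at h
  exact ⟨h1, h2, h⟩

theorem generatesCausalSubmonoid_of_le (hφ : IsLocalFlow ξ D φ)
    (H : ∀ (s : ℝ) (p : V), (s, p) ∈ D → 0 ≤ s → ∀ u ∈ future g o p, ∀ v ∈ future g o p,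
      ∃ c, 0 < c ∧ g.val p u v * c ≤ pullbackTwo (φ s) (fun q u v => g.val q u v) p u v) :
    GeneratesCausalSubmonoid g o D φ where
  pullback_causal s p hs hs0 u hu v hv := by
    obtain ⟨c, hc, hle⟩ := H s p hs hs0.le u hu v hv
    exact (mul_nonneg (nonneg_of_mem_future hu hv) hc.le).trans hle
  map_future s p hs hs0 u hu := mfderiv_mem_future hφ H hs hs0 hu
  diffeo_mem s f hs0 hf := flow_mem_causalSymmetries (fun p => (hf p).2) f.contMDiff
    f.symm.contMDiff fun p _ hu => mfderiv_mem_future hφ H (hf p).1 hs0 hu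
  submonoid hD := by
    have hmem : ∀ s p, (s, p) ∈ D := fun s p => hD ▸ Set.mem_univ _
    have hadd : ∀ s t p, φ s (φ t p) = φ (s + t) p := fun s t p =>
      hφ.map_add s t p (hmem _ _) (hmem _ _) (hmem _ _)
    -- The inverse `φ (-s)` serves only bijectivity and smoothness; it need not preserve the future.
    let f : ℝ → Equiv.Perm V := fun s =>
      { toFun := φ s
        invFun := φ (-s)
        left_inv := fun p => by rw [hadd, neg_add_cancel, hφ.map_zero]
        right_inv := fun p => by rw [hadd, add_neg_cancel, hφ.map_zero] }
    have hsm : ∀ s, ContMDiff 𝓘(ℝ, E) 𝓘(ℝ, E) ∞ (φ s) := fun s p =>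
      hφ.contMDiffAt_right (hmem s p)
    refine ⟨{ toFun := fun s => ⟨f (s.toAdd : ℝ), flow_mem_causalSymmetries (fun _ => rfl) (hsm _)
                (hsm _) fun p _ hu => mfderiv_mem_future hφ H (hmem _ p) s.toAdd.2 hu⟩
              map_one' := ?_
              map_mul' := fun s t => ?_ }, fun s p => rfl⟩
    · exact Subtype.ext (Equiv.ext fun p => hφ.map_zero p)
    · exact Subtype.ext (Equiv.ext fun p => (hadd _ _ p).symm)

theorem generatesCausalSubmonoid_of_causal (hφ : IsLocalFlow ξ D φ)
    {α β : V → ℝ} (hα : Continuous α) (hβ : Continuous β) (hβ0 : ∀ p, 0 ≤ β p)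
    {S : (p : V) → TangentSpace 𝓘(ℝ, E) p → TangentSpace 𝓘(ℝ, E) p → ℝ}
    (hS : ∀ p, IsCausalForm g o p (S p))
    (hLg : HasLieDerivTwo φ (fun p u v => g.val p u v)
      (fun p u v => α p * g.val p u v + β p * S p u v))
    (hLS : HasLieDerivTwo φ S (fun p u v => β p * g.val p u v + α p * S p u v)) :
    GeneratesCausalSubmonoid g o D φ := by
  refine generatesCausalSubmonoid_of_le hφ fun s p hs hs0 u hu v hv => ?_
  have hI : ∀ t ∈ Set.Icc 0 s, (t, p) ∈ D := fun t ht => hφ.mem_of_mem_Icc hs ht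
  have h := exists_mul_le_of_hyperbolic hs0 (hφ.continuousOn_comp hα hI)
    (hφ.continuousOn_comp hβ hI) (fun t _ => hβ0 _)
    (x := fun t => pullbackTwo (φ t) (fun q u v => g.val q u v) p u v)
    (y := fun t => pullbackTwo (φ t) S p u v)
    (fun t ht => (hφ.hasDerivAt_pullbackTwo hLg (hI t ht) u v).hasDerivWithinAt)
    (fun t ht => (hφ.hasDerivAt_pullbackTwo hLS (hI t ht) u v).hasDerivWithinAt)
    (by rw [hφ.pullbackTwo_zero]; exact hS p u hu v hv)
  rwa [hφ.pullbackTwo_zero] at h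

theorem generatesCausalSubmonoid_of_null (hφ : IsLocalFlow ξ D φ)
    {k : (p : V) → TangentSpace 𝓘(ℝ, E) p} (hk : ∀ p, g.val p (k p) (k p) = 0)
    {α β γ : V → ℝ} (hα : Continuous α) (hγ : Continuous γ) (hβ0 : ∀ p, 0 ≤ β p)
    (hLg : HasLieDerivTwo φ (fun p u v => g.val p u v)
      (fun p u v => α p * g.val p u v + β p * (g.val p (k p) u * g.val p (k p) v)))
    (hLk : HasLieDerivOne φ (fun p u => g.val p (k p) u) (fun p u => γ p * g.val p (k p) u)) :
    GeneratesCausalSubmonoid g o D φ := by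
  refine generatesCausalSubmonoid_of_le hφ fun s p hs hs0 u hu v hv => ?_
  have hI : ∀ t ∈ Set.Icc 0 s, (t, p) ∈ D := fun t ht => hφ.mem_of_mem_Icc hs ht
  obtain ⟨A, hA0, hA⟩ := exists_antiderivative hs0 (hφ.continuousOn_comp hα hI)
  obtain ⟨C, hC0, hC⟩ := exists_antiderivative hs0 (hφ.continuousOn_comp hγ hI)
  -- The one-form is only rescaled by e^C, so the source below is β e^{2C} k(u)k(v), whose sign is
  -- decided at `p`.
  have hK : ∀ w : TangentSpace 𝓘(ℝ, E) p, ∀ t ∈ Set.Icc 0 s,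
      pullbackOne (φ t) (fun q u => g.val q (k q) u) p w =
        g.val p (k p) w * Real.exp (C t) := fun w t ht => by
    have hsub : Set.Icc 0 t ⊆ Set.Icc 0 s := Set.Icc_subset_Icc_right ht.2
    have h := eq_mul_exp_of_linear ht.1 hC0 (fun τ hτ => (hC τ (hsub hτ)).mono hsub)
      (y := fun τ => pullbackOne (φ τ) (fun q u => g.val q (k q) u) p w)
      (fun τ hτ => (hφ.hasDerivAt_pullbackOne hLk (hI τ (hsub hτ)) w).hasDerivWithinAt)
    rwa [hφ.pullbackOne_zero] at h
  have h := mul_exp_le_of_linear hs0 hA0 hA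
    (y := fun t => pullbackTwo (φ t) (fun q u v => g.val q u v) p u v)
    (d := fun t => β (φ t p) * (pullbackOne (φ t) (fun q u => g.val q (k q) u) p u *
      pullbackOne (φ t) (fun q u => g.val q (k q) u) p v))
    (fun t ht => (hφ.hasDerivAt_pullbackTwo hLg (hI t ht) u v).hasDerivWithinAt)
    (fun t ht => mul_nonneg (hβ0 _) (by
      rw [hK u t ht, hK v t ht, mul_mul_mul_comm]
      exact mul_nonneg ((g.isLorentz p).mul_nonneg_of_causal (o.timelike p) (hk p).ge hu.1 hu.2
        hv.1 hv.2) (mul_self_nonneg _)))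
  rw [hφ.pullbackTwo_zero] at h
  exact ⟨_, Real.exp_pos _, h⟩

end Generates

end Geometry

end CausalSym

theorem mainTheorem3
    {E : Type*} [NormedAddCommGroup E] [NormedSpace ℝ E] [FiniteDimensional ℝ E]
    {V : Type*} [TopologicalSpace V] [ChartedSpace E V] [IsManifold 𝓘(ℝ, E) ∞ V]
    (g : CausalSym.LorentzMetric E V) (o : CausalSym.TimeOrientation g)
    (ξ : (p : V) → TangentSpace 𝓘(ℝ, E) p) (hξ : CausalSym.SmoothField ξ)
    (D : Set (ℝ × V)) (φ : ℝ → V → V) (hφ : CausalSym.IsLocalFlow ξ D φ) :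
    -- `r = m + 1` independent null directions with `2 ≤ r ≤ n - 1`, including `r = n - 1`
    (∀ (m : ℕ), 1 ≤ m → m + 1 ≤ Module.finrank ℝ E - 1 →
      ∀ (k : Fin (m + 1) → (p : V) → TangentSpace 𝓘(ℝ, E) p),
        (∀ i p, g.val p (k i p) (k i p) = 0) →
        (∀ p, LinearIndependent ℝ (fun i => k i p)) →
        (∀ p, CausalSym.selfContract g p (CausalSym.wedge g p (fun i => k i p)) =
          2 * ((m + 1).factorial : ℝ) * (-1) ^ m) →
      ∀ (α β : V → ℝ), ContMDiff 𝓘(ℝ, E) 𝓘(ℝ, ℝ) ∞ α → ContMDiff 𝓘(ℝ, E) 𝓘(ℝ, ℝ) ∞ β →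
        (∀ p, 0 < β p) →
      ∀ (S : (p : V) → TangentSpace 𝓘(ℝ, E) p → TangentSpace 𝓘(ℝ, E) p → ℝ),
        (∀ p, S p = CausalSym.superEnergy g p (CausalSym.wedge g p (fun i => k i p))) →
        CausalSym.HasLieDerivTwo φ (fun p u v => g.val p u v)
          (fun p u v => α p * g.val p u v + β p * S p u v) →
        CausalSym.HasLieDerivTwo φ S
          (fun p u v => β p * g.val p u v + α p * S p u v) →
        CausalSym.GeneratesCausalSubmonoid g o D φ) ∧
    -- the degenerate case `r = 1`
    (∀ (k : (p : V) → TangentSpace 𝓘(ℝ, E) p),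
        (∀ p, k p ≠ 0) → (∀ p, g.val p (k p) (k p) = 0) →
      ∀ (α β γ : V → ℝ), ContMDiff 𝓘(ℝ, E) 𝓘(ℝ, ℝ) ∞ α → ContMDiff 𝓘(ℝ, E) 𝓘(ℝ, ℝ) ∞ β →
        ContMDiff 𝓘(ℝ, E) 𝓘(ℝ, ℝ) ∞ γ → (∀ p, 0 < β p) →
        CausalSym.HasLieDerivTwo φ (fun p u v => g.val p u v)
          (fun p u v => α p * g.val p u v + β p * (g.val p (k p) u * g.val p (k p) v)) →
        CausalSym.HasLieDerivOne φ (fun p u => g.val p (k p) u)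
          (fun p u => γ p * g.val p (k p) u) →
        CausalSym.GeneratesCausalSubmonoid g o D φ) := by
  refine ⟨fun m _ _ k hk _ hn α β hα hβ hβ0 S hS hLg hLS => ?_,
    fun k _ hk α β γ hα _ hγ hβ0 hLg hLk => ?_⟩
  · exact CausalSym.generatesCausalSubmonoid_of_causal hφ hα.continuous hβ.continuous
      (fun p => (hβ0 p).le)
      (fun p => hS p ▸ CausalSym.isCausalForm_superEnergy g o p (fun i => hk i p) (hn p)) hLg hLS
  · exact CausalSym.generatesCausalSubmonoid_of_null hφ hk hα.continuous hγ.continuous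
      (fun p => (hβ0 p).le) hLg hLk
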